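/- Let $A$ and $B$ be $C^*$-algebras. A right Hilbert $A$-module $X_A$ is a right $A$-module with an $A$-valued inner product $(\cdot\mid\cdot)_A$ (linear in the second variable) that is complete in the induced norm. Write $\mathrm{End}_A(X)$ for its $C^*$-algebra of adjointable operators, $\Theta_{x,y}$ for the rank-one operator $\Theta_{x,y}(z)=x\cdot(y\mid z)_A$, and $\mathrm{End}^0_A(X)$ for the closed linear span of the $\Theta_{x,y}$. A net $(T_\lambda)$ in $\mathrm{End}_A(X)$ converges strictly to $T$ if $\|T_\lambda K-TK\|\to 0$ and $\|KT_\lambda-KT\|\to 0$ for every $K\in\mathrm{End}^0_A(X)$. A sequence $(x_j)_{j\in\mathbb N}$ in $X_A$ is a countable frame for $X_A$ if the partial sums of $\sum_{j}\Theta_{x_j,x_j}$ converge strictly to the identity operator. **Proposition.** Let $X_A$ be a right Hilbert $A$-module and let $(\phi,{}_AY_B)$ be an $A$–$B$-correspondence, that is, $Y_B$ is a right Hilbert $B$-module and $\phi\colon A\to\mathrm{End}_B(Y)$ is a $*$-homomorphism. Let $(x_i)_{i\in\mathbb N}$ be a countable frame for $X_A$ and let $(y_j)_{j\in\mathbb N}$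 be a countable frame for $Y_B$. Then $(x_i\otimes y_j)_{i,j\in\mathbb N}$ is a countable frame for the interior tensor product $X\otimes_\phi Y$, the right Hilbert $B$-module obtained by separating and completing the algebraic tensor product with respect to $(x\otimes y\mid x'\otimes y')_B=(y\mid\phi((x\mid x')_A)\,y')_B$. More precisely, the net of sums $\sum_{(i,j)\in\Sigma}\Theta_{x_i\otimes y_j,\,x_i\otimes y_j}$ over the finite subsets $\Sigma\subset\mathbb N^2$, directed by inclusion, converges strictly to the identity of $\mathrm{End}_B(X\otimes_\phi Y)$, and $(x_i\otimes y_j)$ arranged in a sequence by any bijection $\mathbb N\to\mathbb N^2$ is a countable frame. -/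

import Mathlib

open MulOpposite Filter Topology
open scoped TensorProduct InnerProductSpace

set_option linter.unusedSectionVars false

noncomputable section

/-!
Conventions.  A right Hilbert module over a `C⋆`-algebra `A` is a Banach space `X` with
`CStarModule Aᵐᵒᵖ X`: the right action is `x · a = op a • x`, the `A`-valued inner product,
conjugate linear in the first and `A`-linear in the second variable, is
`(x | y)_A = unop ⟪x, y⟫_Aᵐᵒᵖ`.  Statements that do not use the order of multiplication are
written for `CStarModule C E` with `C` arbitrary, to be read with `C = Aᵐᵒᵖ`.
-/

namespace HilbertModule

section Basic

variable (C : Type*) {E : Type*} [NonUnitalCStarAlgebra C] [PartialOrder C] [StarOrderedRing C]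
  [NormedAddCommGroup E] [NormedSpace ℂ E] [SMul C E] [CStarModule C E]

theorem ext_inner {x y : E} (h : ∀ z : E, ⟪z, x⟫_C = ⟪z, y⟫_C) : x = y := by
  rw [← sub_eq_zero]
  apply (CStarModule.inner_self (A := C)).mp
  rw [CStarModule.inner_sub_right, h, sub_self]

theorem smul_add' (c : C) (x y : E) : c • (x + y) = c • x + c • y :=
  ext_inner C fun z => by simp [mul_add]

theorem smul_neg' (c : C) (x : E) : c • (-x) = -(c • x) :=
  ext_inner C fun z => by simp

theorem smul_sub' (c : C) (x y : E) : c • (x - y) = c • x - c • y :=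
  ext_inner C fun z => by simp [mul_sub]

theorem add_smul' (c d : C) (x : E) : (c + d) • x = c • x + d • x :=
  ext_inner C fun z => by simp [add_mul]

theorem smul_complex_smul (c : C) (t : ℂ) (x : E) : c • (t • x) = t • (c • x) :=
  ext_inner C fun z => by simp [mul_smul_comm]

theorem complex_smul_smul (c : C) (t : ℂ) (x : E) : (t • c) • x = t • (c • x) :=
  ext_inner C fun z => by simp [smul_mul_assoc]

theorem norm_smul_le' (c : C) (x : E) : ‖c • x‖ ≤ ‖c‖ * ‖x‖ := by
  refine abs_le_of_sq_le_sq' ?_ (by positivity) |>.2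
  rw [CStarModule.norm_sq_eq C, mul_pow, CStarModule.norm_sq_eq C (x := x)]
  calc ‖⟪c • x, c • x⟫_C‖ = ‖c * (⟪x, x⟫_C * star c)‖ := by simp
    _ ≤ ‖c‖ * (‖⟪x, x⟫_C‖ * ‖star c‖) :=
        (norm_mul_le _ _).trans (by gcongr; exact norm_mul_le _ _)
    _ = ‖c‖ ^ 2 * ‖⟪x, x⟫_C‖ := by rw [norm_star]; ring

variable (E)

/-- The algebra `End_C(E)` of adjointable operators on the Hilbert module `E`,
with the operator norm. -/
def Adjointable : Subalgebra ℂ (E →L[ℂ] E) where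
  carrier := {T | ∃ S : E →L[ℂ] E, ∀ x y : E, ⟪T x, y⟫_C = ⟪x, S y⟫_C}
  mul_mem' := by
    rintro T T' ⟨S, hS⟩ ⟨S', hS'⟩
    exact ⟨S' * S, fun x y => by simp [hS, hS']⟩
  add_mem' := by
    rintro T T' ⟨S, hS⟩ ⟨S', hS'⟩
    exact ⟨S + S', fun x y => by simp [hS, hS']⟩
  algebraMap_mem' t := ⟨star t • 1, fun x y => by
    simp [Algebra.algebraMap_eq_smul_one]⟩

variable {C E}

namespace Adjointable

/-- The adjoint of an adjointable operator. -/
instance : Star (Adjointable C E) where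
  star T := ⟨T.2.choose, T.1, fun x y => by
    rw [← CStarModule.star_inner, ← T.2.choose_spec, CStarModule.star_inner]⟩

theorem inner_left (T : Adjointable C E) (x y : E) :
    ⟪T.1 x, y⟫_C = ⟪x, (star T).1 y⟫_C :=
  T.2.choose_spec x y

theorem inner_right (T : Adjointable C E) (x y : E) :
    ⟪x, T.1 y⟫_C = ⟪(star T).1 x, y⟫_C := by
  rw [← CStarModule.star_inner, inner_left, CStarModule.star_inner]

theorem eq_star {T S : Adjointable C E} (h : ∀ x y : E, ⟪T.1 x, y⟫_C = ⟪x, S.1 y⟫_C) :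
    star T = S :=
  Subtype.ext <| ContinuousLinearMap.ext fun y => ext_inner C fun x => by
    rw [← inner_left, h]

instance : StarRing (Adjointable C E) where
  star_involutive T := eq_star fun x y => by rw [inner_right]
  star_mul T S := eq_star fun x y => by
    simp only [MulMemClass.coe_mul, mul_apply_eq_comp, inner_left]
  star_add T S := eq_star fun x y => by
    simp only [Subalgebra.coe_add, add_apply, inner_left,
      CStarModule.inner_add_left, CStarModule.inner_add_right]

end Adjointable

/-- The rank-one operator `Θ_{x,y} z = x · (y | z)`. -/
def rankOne (x y : E) : Adjointable C E :=
  ⟨LinearMap.mkContinuous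
    { toFun := fun z => ⟪y, z⟫_C • x
      map_add' := fun z w => by rw [CStarModule.inner_add_right, add_smul']
      map_smul' := fun t z => by
        rw [CStarModule.inner_smul_right_complex, complex_smul_smul, RingHom.id_apply] }
    (‖y‖ * ‖x‖) (fun z => (norm_smul_le' C _ _).trans <| by
      have := CStarModule.norm_inner_le (A := C) E (x := y) (y := z)
      calc ‖⟪y, z⟫_C‖ * ‖x‖ ≤ (‖y‖ * ‖z‖) * ‖x‖ := by gcongr
        _ = ‖y‖ * ‖x‖ * ‖z‖ := by ring),
   LinearMap.mkContinuous
    { toFun := fun z => ⟪x, z⟫_C • y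
      map_add' := fun z w => by rw [CStarModule.inner_add_right, add_smul']
      map_smul' := fun t z => by
        rw [CStarModule.inner_smul_right_complex, complex_smul_smul, RingHom.id_apply] }
    (‖x‖ * ‖y‖) (fun z => (norm_smul_le' C _ _).trans <| by
      have := CStarModule.norm_inner_le (A := C) E (x := x) (y := z)
      calc ‖⟪x, z⟫_C‖ * ‖y‖ ≤ (‖x‖ * ‖z‖) * ‖y‖ := by gcongr
        _ = ‖x‖ * ‖y‖ * ‖z‖ := by ring),
   fun z w => by
    simp⟩

theorem rankOne_apply (x y z : E) : (rankOne (C := C) x y).1 z = ⟪y, z⟫_C • x := rfl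

variable (C E)

/-- The ideal `End⁰_C(E)` of generalised compact operators: the operator norm closure of the
finite-rank operators, i.e. of the linear span of the rank-one operators. -/
def compacts : Submodule ℂ (Adjointable C E) :=
  (Submodule.span ℂ (Set.range fun p : E × E => rankOne (C := C) p.1 p.2)).topologicalClosure

/-- The strict topology on `End_C(E)`, the multiplier algebra of `End⁰_C(E)`: the coarsest
topology for which `T ↦ T K` and `T ↦ K T` are norm continuous for all generalised compact `K`. -/
abbrev strictTopology : TopologicalSpace (Adjointable C E) :=
  TopologicalSpace.induced (fun T (K : compacts C E) => (T * K.1, K.1 * T)) inferInstance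

variable {E}

/-- `(x_j)_{j ∈ ℕ}` is a countable frame: the partial sums of `∑ Θ_{x_j, x_j}` converge strictly
to the identity operator. -/
def IsCountableFrame (x : ℕ → E) : Prop :=
  Tendsto (fun n => ∑ j ∈ Finset.range n, rankOne (C := C) (x j) (x j)) atTop
    (@nhds _ (strictTopology C E) 1)

/-- A frame indexed by a set `ι` without a preferred order: the net of the sums of
`Θ_{x_i, x_i}` over the finite subsets of `ι` converges strictly to the identity operator. -/
def IsUnorderedFrame {ι : Type*} (x : ι → E) : Prop :=
  Tendsto (fun s : Finset ι => ∑ i ∈ s, rankOne (C := C) (x i) (x i)) atTop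
    (@nhds _ (strictTopology C E) 1)

end Basic

/-! ### Completion of an inner product module -/

section Completion

open UniformSpace

variable {C E : Type*} [NonUnitalCStarAlgebra C] [PartialOrder C] [StarOrderedRing C]
  [NormedAddCommGroup E] [NormedSpace ℂ E] [SMul C E] [CStarModule C E]

theorem uniformContinuousConstSMul : UniformContinuousConstSMul C E where
  uniformContinuous_const_smul c := by
    refine (LipschitzWith.of_dist_le_mul (K := ‖c‖₊) fun x y => ?_).uniformContinuous
    rw [dist_eq_norm, dist_eq_norm, ← smul_sub' C]
    exact norm_smul_le' C c (x - y)

theorem completion_coe_smul (c : C) (x : E) : ((c • x : E) : Completion E) = c • (x : Completion E) :=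
  haveI := uniformContinuousConstSMul (C := C) (E := E)
  Completion.coe_smul c x

theorem completion_continuous_smul (c : C) : Continuous fun x : Completion E => c • x :=
  haveI := uniformContinuousConstSMul (C := C) (E := E)
  continuous_const_smul c

theorem completion_inner_coe (x y : E) :
    ⟪(x : Completion E), (y : Completion E)⟫_C = ⟪x, y⟫_C :=
  (Completion.isDenseInducing_coe.prodMap Completion.isDenseInducing_coe).extend_eq
    (CStarModule.continuous_inner : Continuous fun p : E × E => ⟪p.1, p.2⟫_C) (x, y)

theorem completion_continuous_inner :
    Continuous (Function.uncurry (inner C (E := Completion E))) := by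
  let inner' : E →+ E →+ C :=
    { toFun := fun x => (CStarModule.innerₛₗ (A := C) x).toAddMonoidHom
      map_zero' := by ext x; exact CStarModule.inner_zero_left
      map_add' := fun x y => by ext z; exact CStarModule.inner_add_left }
  have h : Continuous fun p : E × E => inner' p.1 p.2 :=
    (CStarModule.continuous_inner : Continuous fun p : E × E => ⟪p.1, p.2⟫_C)
  rw [Completion.toInner, inner, Function.uncurry_curry _]
  change
    Continuous
      (((Completion.isDenseInducing_toCompl E).prodMap
        (Completion.isDenseInducing_toCompl E)).extend fun p : E × E => inner' p.1 p.2)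
  exact (Completion.isDenseInducing_toCompl E).extend_Z_bilin
    (Completion.isDenseInducing_toCompl E) h

theorem completion_continuous_inner' {T : Type*} [TopologicalSpace T] {f g : T → Completion E}
    (hf : Continuous f) (hg : Continuous g) : Continuous fun t => ⟪f t, g t⟫_C :=
  completion_continuous_inner.comp (hf.prodMk hg)

theorem completion_norm_eq (x : Completion E) : ‖x‖ = √‖⟪x, x⟫_C‖ :=
  Completion.induction_on x
    (isClosed_eq continuous_norm
      (completion_continuous_inner' continuous_id continuous_id).norm.sqrt)
    fun a => by
      rw [Completion.norm_coe, completion_inner_coe, CStarModule.norm_eq_sqrt_norm_inner_self (A := C)]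

/-- The completion of an inner product `C`-module is a Hilbert `C`-module; action and inner
product are the continuous extensions. -/
instance completionCStarModule : CStarModule C (Completion E) where
  inner_add_right {x y z} :=
    Completion.induction_on₃ x y z
      (isClosed_eq
        (completion_continuous_inner' (by fun_prop) (by fun_prop))
        ((completion_continuous_inner' (by fun_prop) (by fun_prop)).add
          (completion_continuous_inner' (by fun_prop) (by fun_prop))))
      fun a b c => by
        rw [← Completion.coe_add]
        simp only [completion_inner_coe, CStarModule.inner_add_right]
  inner_self_nonneg {x} :=
    Completion.induction_on x
      (isClosed_le continuous_const (completion_continuous_inner' continuous_id continuous_id))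
      fun a => by rw [completion_inner_coe]; exact CStarModule.inner_self_nonneg
  inner_self {x} := by
    rw [← norm_eq_zero (a := x), completion_norm_eq (C := C), Real.sqrt_eq_zero (norm_nonneg _),
      norm_eq_zero]
  inner_op_smul_right {c x y} :=
    Completion.induction_on₂ x y
      (isClosed_eq
        (completion_continuous_inner' continuous_fst
          ((completion_continuous_smul c).comp continuous_snd))
        (continuous_const.mul (completion_continuous_inner' continuous_fst continuous_snd)))
      fun a b => by
        rw [← completion_coe_smul]
        simp only [completion_inner_coe, CStarModule.inner_op_smul_right]
  inner_smul_right_complex {t x y} :=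
    Completion.induction_on₂ x y
      (isClosed_eq
        (completion_continuous_inner' continuous_fst (continuous_snd.const_smul t))
        ((completion_continuous_inner' continuous_fst continuous_snd).const_smul t))
      fun a b => by
        rw [← Completion.coe_smul]
        simp only [completion_inner_coe, CStarModule.inner_smul_right_complex]
  star_inner x y :=
    Completion.induction_on₂ x y
      (isClosed_eq
        (completion_continuous_inner' continuous_fst continuous_snd).star
        (completion_continuous_inner' continuous_snd continuous_fst))
      fun a b => by simp only [completion_inner_coe, CStarModule.star_inner]
  norm_eq_sqrt_norm_inner_self x := completion_norm_eq x

end Completion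

/-! ### The interior tensor product -/

section Positivity

variable {A : Type*} [NonUnitalCStarAlgebra A] [PartialOrder A] [StarOrderedRing A]

theorem nonneg_factor {G : A} (hG : 0 ≤ G) : ∃ c : A, G = star c * c :=
  CStarAlgebra.nonneg_iff_eq_star_mul_self.mp hG

theorem matrix_eq_zero_of_diag {n : Type*} [Fintype n] [DecidableEq n] (P : CStarMatrix n n A)
    (hP : 0 ≤ P) (h : ∀ k, P k k ≤ 0) : P = 0 := by
  obtain ⟨d, rfl⟩ := nonneg_factor hP
  have hd : d = 0 := by
    ext i k
    have h1 : ∑ j, star (d j k) * d j k ≤ 0 := h k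
    have h2 : star (d i k) * d i k ≤ 0 :=
      (Finset.single_le_sum (f := fun j => star (d j k) * d j k)
        (fun j _ => star_mul_self_nonneg _) (Finset.mem_univ i)).trans h1
    exact (CStarRing.star_mul_self_eq_zero_iff _).mp (le_antisymm h2 (star_mul_self_nonneg _))
  rw [hd, mul_zero]

theorem exists_negPart (G : A) (hsa : IsSelfAdjoint G) :
    ∃ N : A, IsSelfAdjoint N ∧ N * G * N = -(N * N * N) ∧ 0 ≤ N * N * N ∧
      (N * N * N = 0 → 0 ≤ G) := by
  have hneg : IsSelfAdjoint G⁻ := (CFC.negPart_nonneg G).isSelfAdjoint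
  refine ⟨G⁻, hneg, ?_, ?_, fun h => ?_⟩
  · have h : G⁻ * G = -(G⁻ * G⁻) := by
      conv_lhs =>
        rhs
        rw [← CFC.posPart_sub_negPart G hsa]
      rw [mul_sub, CFC.negPart_mul_posPart, zero_sub]
    rw [h, neg_mul]
  · have := star_left_conjugate_nonneg (CFC.negPart_nonneg G) G⁻
    rwa [hneg.star_eq] at this
  · have h7 : star (G⁻ * G⁻) * (G⁻ * G⁻) = 0 := by
      rw [star_mul, hneg.star_eq, ← mul_assoc, h, zero_mul]
    have h8 : star (G⁻) * G⁻ = 0 := by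
      rw [hneg.star_eq]; exact (CStarRing.star_mul_self_eq_zero_iff _).mp h7
    rw [← CFC.posPart_sub_negPart G hsa, (CStarRing.star_mul_self_eq_zero_iff _).mp h8, sub_zero]
    exact CFC.posPart_nonneg G

theorem matrix_factor {n : Type*} [Fintype n] [DecidableEq n] (G : CStarMatrix n n A)
    (hsa : star G = G) (hG : ∀ a : n → A, 0 ≤ ∑ i, ∑ j, star (a i) * G i j * a j) :
    ∃ c : CStarMatrix n n A, ∀ i j, G i j = ∑ k, star (c k i) * c k j := by
  obtain ⟨N, hN, h3, hcube, hpos⟩ := exists_negPart G hsa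
  have hzero : N * N * N = 0 := by
    refine matrix_eq_zero_of_diag _ hcube fun k => ?_
    have h4 : (N * G * N) k k = ∑ i, ∑ j, star (N i k) * G i j * N j k := by
      have h5 : ∀ i, N k i = star (N i k) := fun i => by
        conv_lhs => rw [← hN.star_eq]
        rfl
      rw [CStarMatrix.mul_apply, Finset.sum_comm]
      refine Finset.sum_congr rfl fun j _ => ?_
      rw [CStarMatrix.mul_apply, Finset.sum_mul]
      exact Finset.sum_congr rfl fun i _ => by rw [h5]
    have h6 : 0 ≤ (N * G * N) k k := h4 ▸ hG fun i => N i k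
    rw [h3] at h6
    exact neg_nonneg.mp h6
  obtain ⟨c, hc⟩ := nonneg_factor (hpos hzero)
  exact ⟨c, fun i j => by rw [congrFun (congrFun hc i) j]; rfl⟩

end Positivity

section InteriorTensor

variable {A C : Type*} [NonUnitalCStarAlgebra A] [PartialOrder A] [StarOrderedRing A]
  [NonUnitalCStarAlgebra C] [PartialOrder C] [StarOrderedRing C]
  (X : Type*) [NormedAddCommGroup X] [NormedSpace ℂ X] [SMul Aᵐᵒᵖ X] [CStarModule Aᵐᵒᵖ X]
  {Y : Type*} [NormedAddCommGroup Y] [NormedSpace ℂ Y] [SMul C Y] [CStarModule C Y]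
  (φ : A →⋆ₙₐ[ℂ] Adjointable C Y)

/-- The sesquilinear form `(x ⊗ y | x' ⊗ y') = (y | φ((x | x')_A) y')` on the algebraic tensor
product of a right Hilbert `A`-module `X` and a correspondence `Y`. -/
def tensorForm : X ⊗[ℂ] Y →ₗ⋆[ℂ] X ⊗[ℂ] Y →ₗ[ℂ] C :=
  TensorProduct.lift <| LinearMap.mk₂'ₛₗ (starRingEnd ℂ) (starRingEnd ℂ)
    (fun x y => TensorProduct.lift <| LinearMap.mk₂ ℂ
      (fun x' y' => ⟪y, (φ (unop ⟪x, x'⟫_Aᵐᵒᵖ)).1 y'⟫_C)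
      (fun x₁ x₂ y' => by simp)
      (fun t x' y' => by simp)
      (fun x' y₁ y₂ => by simp)
      (fun t x' y' => by simp))
    (fun x₁ x₂ y => TensorProduct.ext' fun x' y' => by simp)
    (fun t x y => TensorProduct.ext' fun x' y' => by simp)
    (fun x y₁ y₂ => TensorProduct.ext' fun x' y' => by simp)
    (fun t x y => TensorProduct.ext' fun x' y' => by simp)

variable {X}

theorem tensorForm_tmul (x x' : X) (y y' : Y) :
    tensorForm X φ (x ⊗ₜ y) (x' ⊗ₜ y') = ⟪y, (φ (unop ⟪x, x'⟫_Aᵐᵒᵖ)).1 y'⟫_C := rfl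

theorem star_tensorForm (u v : X ⊗[ℂ] Y) : star (tensorForm X φ u v) = tensorForm X φ v u := by
  induction u with
  | zero => simp
  | add u₁ u₂ h₁ h₂ => simp [h₁, h₂]
  | tmul x y =>
    induction v with
    | zero => simp
    | add v₁ v₂ h₁ h₂ => simp [h₁, h₂]
    | tmul x' y' =>
      rw [tensorForm_tmul, tensorForm_tmul, CStarModule.star_inner, Adjointable.inner_left,
        ← map_star, ← unop_star, CStarModule.star_inner]

theorem tensorForm_self_nonneg (u : X ⊗[ℂ] Y) : 0 ≤ tensorForm X φ u u := by
  classical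
  obtain ⟨n, x, y, rfl⟩ := TensorProduct.exists_sum_tmul_eq u
  obtain ⟨c, hc⟩ := matrix_factor
    (CStarMatrix.ofMatrix fun i j : Fin n => unop ⟪x i, x j⟫_Aᵐᵒᵖ)
    (by
      ext i j
      change star (unop ⟪x j, x i⟫_Aᵐᵒᵖ) = unop ⟪x i, x j⟫_Aᵐᵒᵖ
      rw [← unop_star, CStarModule.star_inner])
    (fun a => by
      have h : 0 ≤ unop ⟪∑ i, op (a i) • x i, ∑ i, op (a i) • x i⟫_Aᵐᵒᵖ :=
        (CStarModule.inner_self_nonneg : (0 : Aᵐᵒᵖ) ≤ _)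
      simp only [CStarModule.inner_sum_left, CStarModule.inner_sum_right,
        CStarModule.inner_op_smul_right, CStarModule.inner_op_smul_left] at h
      simp only [Finset.mul_sum] at h
      rw [Finset.sum_comm] at h
      change 0 ≤ ∑ i, ∑ j, star (a i) * unop ⟪x i, x j⟫_Aᵐᵒᵖ * a j
      simpa [Finset.unop_sum, mul_assoc] using h)
  have hc' : ∀ i j, unop ⟪x i, x j⟫_Aᵐᵒᵖ = ∑ k, star (c k i) * c k j := hc
  have h : tensorForm X φ (∑ i, x i ⊗ₜ y i) (∑ i, x i ⊗ₜ y i) =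
      ∑ k, ⟪∑ i, (φ (c k i)).1 (y i), ∑ i, (φ (c k i)).1 (y i)⟫_C := by
    simp only [map_sum, LinearMap.sum_apply, tensorForm_tmul, hc', map_mul, map_star,
      CStarModule.inner_sum_left, CStarModule.inner_sum_right]
    have h2 : ∀ i j, ⟪y i, (∑ k, star (φ (c k i)) * φ (c k j) : Adjointable C Y).1 (y j)⟫_C =
        ∑ k, ⟪(φ (c k i)).1 (y i), (φ (c k j)).1 (y j)⟫_C := fun i j => by
      simp [Adjointable.inner_left]
    simp only [h2]
    rw [Finset.sum_congr rfl fun j _ => Finset.sum_comm, Finset.sum_comm]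
  rw [h]
  exact Finset.sum_nonneg fun k _ => CStarModule.inner_self_nonneg

/-- The right action on the algebraic tensor product, `(x ⊗ y) · b = x ⊗ (y · b)`. -/
def tensorAct (c : C) : X ⊗[ℂ] Y →ₗ[ℂ] X ⊗[ℂ] Y :=
  LinearMap.lTensor X
    { toFun := fun y => c • y
      map_add' := fun y y' => smul_add' C c y y'
      map_smul' := fun t y => smul_complex_smul C c t y }

theorem tensorForm_act (c : C) (u v : X ⊗[ℂ] Y) :
    tensorForm X φ u (tensorAct c v) = c * tensorForm X φ u v := by
  induction u with
  | zero => simp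
  | add u₁ u₂ h₁ h₂ => simp [h₁, h₂, mul_add]
  | tmul x y =>
    induction v with
    | zero => simp
    | add v₁ v₂ h₁ h₂ => simp [h₁, h₂, mul_add]
    | tmul x' y' =>
      change ⟪y, (φ (unop ⟪x, x'⟫_Aᵐᵒᵖ)).1 (c • y')⟫_C =
        c * ⟪y, (φ (unop ⟪x, x'⟫_Aᵐᵒᵖ)).1 y'⟫_C
      rw [Adjointable.inner_right, CStarModule.inner_op_smul_right, Adjointable.inner_right]

theorem tensorForm_act_left (c : C) (u v : X ⊗[ℂ] Y) :
    tensorForm X φ (tensorAct c u) v = tensorForm X φ u v * star c := by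
  rw [← star_tensorForm, tensorForm_act, star_mul, star_tensorForm]

theorem tensorForm_eq_zero {u : X ⊗[ℂ] Y} (hu : tensorForm X φ u u = 0) (v : X ⊗[ℂ] Y) :
    tensorForm X φ v u = 0 := by
  set w := tensorForm X φ v u with hw
  have key : ∀ n : ℕ, n • (star w * w) ≤ tensorForm X φ v v := fun n => by
    have h := tensorForm_self_nonneg φ (v - (n : ℂ) • tensorAct (star w) u)
    have h1 : tensorForm X φ (v - (n : ℂ) • tensorAct (star w) u)
        (v - (n : ℂ) • tensorAct (star w) u) =
        tensorForm X φ v v - n • (star w * w) - n • (star w * w) := by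
      have h2 : tensorForm X φ u v = star w := by rw [hw, star_tensorForm]
      simp only [map_sub, LinearMap.sub_apply, LinearMap.map_smulₛₗ, LinearMap.smul_apply,
        tensorForm_act, tensorForm_act_left, hu, h2, star_star, ← hw]
      simp [Nat.cast_smul_eq_nsmul ℂ]
    rw [h1, sub_nonneg] at h
    exact h.trans (sub_le_self _ (nsmul_nonneg (star_mul_self_nonneg w) n))
  by_contra hne
  obtain ⟨n, hn⟩ := exists_nat_gt (‖tensorForm X φ v v‖ / ‖w‖ ^ 2)
  have hpos : 0 < ‖w‖ ^ 2 := by positivity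
  have h1 := CStarAlgebra.norm_le_norm_of_nonneg_of_le
    (nsmul_nonneg (star_mul_self_nonneg w) n) (key n)
  rw [← Nat.cast_smul_eq_nsmul ℝ, norm_smul, CStarRing.norm_star_mul_self, ← sq] at h1
  rw [div_lt_iff₀ hpos] at hn
  simp only [Real.norm_natCast] at h1
  exact absurd h1 (not_le.mpr hn)

variable (X)

/-- The vectors of length zero in the algebraic tensor product. -/
def nullVectors : Submodule ℂ (X ⊗[ℂ] Y) where
  carrier := {u | tensorForm X φ u u = 0}
  zero_mem' := by simp
  add_mem' {u v} hu hv := by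
    simp only [Set.mem_ofPred_eq] at hu hv ⊢
    simp [tensorForm_eq_zero φ hu, tensorForm_eq_zero φ hv]
  smul_mem' t u hu := by
    simp only [Set.mem_ofPred_eq] at hu ⊢
    simp [hu]

/-- The algebraic tensor product modulo the vectors of length zero. -/
def PreInteriorTensor : Type _ := (X ⊗[ℂ] Y) ⧸ nullVectors X φ

namespace PreInteriorTensor

instance : AddCommGroup (PreInteriorTensor X φ) :=
  inferInstanceAs (AddCommGroup ((X ⊗[ℂ] Y) ⧸ nullVectors X φ))

instance : Module ℂ (PreInteriorTensor X φ) :=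
  inferInstanceAs (Module ℂ ((X ⊗[ℂ] Y) ⧸ nullVectors X φ))

variable {X}

/-- The quotient map. -/
def mk : X ⊗[ℂ] Y →ₗ[ℂ] PreInteriorTensor X φ := (nullVectors X φ).mkQ

theorem mk_surjective : Function.Surjective (mk (X := X) φ) := (nullVectors X φ).mkQ_surjective

theorem tensorForm_congr {u u' v v' : X ⊗[ℂ] Y} (hu : mk φ u = mk φ u')
    (hv : mk φ v = mk φ v') : tensorForm X φ u v = tensorForm X φ u' v' := by
  have hu' : tensorForm X φ (u - u') (u - u') = 0 := (Submodule.Quotient.eq _).mp hu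
  have hv' : tensorForm X φ (v - v') (v - v') = 0 := (Submodule.Quotient.eq _).mp hv
  have h1 : tensorForm X φ u (v - v') = 0 := tensorForm_eq_zero φ hv' u
  have h2 : tensorForm X φ v' (u - u') = 0 := tensorForm_eq_zero φ hu' v'
  rw [map_sub, sub_eq_zero] at h1 h2
  rw [h1, ← star_tensorForm, h2, star_tensorForm]

variable (X)

instance : Inner C (PreInteriorTensor X φ) where
  inner p q := tensorForm X φ (mk_surjective φ p).choose (mk_surjective φ q).choose

instance : SMul C (PreInteriorTensor X φ) where
  smul c p := mk φ (tensorAct c (mk_surjective φ p).choose)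

instance : Norm (PreInteriorTensor X φ) := CStarModule.norm C

variable {X}

/-- The inner product of classes is the form of representatives. -/
theorem inner_mk (u v : X ⊗[ℂ] Y) : ⟪mk φ u, mk φ v⟫_C = tensorForm X φ u v :=
  tensorForm_congr φ (mk_surjective φ _).choose_spec (mk_surjective φ _).choose_spec

/-- The action on classes is the action on representatives. -/
theorem smul_mk (c : C) (u : X ⊗[ℂ] Y) : c • mk φ u = mk φ (tensorAct c u) := by
  set w := (mk_surjective φ (mk φ u)).choose with hw
  have h : mk φ w = mk φ u := (mk_surjective φ (mk φ u)).choose_spec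
  change mk φ (tensorAct c w) = mk φ (tensorAct c u)
  have h' : tensorForm X φ (w - u) (w - u) = 0 := (Submodule.Quotient.eq _).mp h
  refine (Submodule.Quotient.eq _).mpr ?_
  change tensorForm X φ (tensorAct c w - tensorAct c u) (tensorAct c w - tensorAct c u) = 0
  rw [← map_sub, tensorForm_act, tensorForm_act_left, h', zero_mul, mul_zero]

variable (X)

instance : CStarModule C (PreInteriorTensor X φ) where
  inner_add_right {p q r} := by
    obtain ⟨u, rfl⟩ := mk_surjective φ p
    obtain ⟨v, rfl⟩ := mk_surjective φ q
    obtain ⟨w, rfl⟩ := mk_surjective φ r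
    rw [← map_add, inner_mk, inner_mk, inner_mk, map_add]
  inner_self_nonneg {p} := by
    obtain ⟨u, rfl⟩ := mk_surjective φ p
    rw [inner_mk]
    exact tensorForm_self_nonneg φ u
  inner_self {p} := by
    obtain ⟨u, rfl⟩ := mk_surjective φ p
    rw [inner_mk]
    exact ((nullVectors X φ).mkQ_apply u ▸ (Submodule.Quotient.mk_eq_zero _).symm :
      u ∈ nullVectors X φ ↔ mk φ u = 0)
  inner_op_smul_right {c p q} := by
    obtain ⟨u, rfl⟩ := mk_surjective φ p
    obtain ⟨v, rfl⟩ := mk_surjective φ q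
    rw [smul_mk, inner_mk, inner_mk, tensorForm_act]
  inner_smul_right_complex {t p q} := by
    obtain ⟨u, rfl⟩ := mk_surjective φ p
    obtain ⟨v, rfl⟩ := mk_surjective φ q
    rw [← map_smul, inner_mk, inner_mk, map_smul]
  star_inner p q := by
    obtain ⟨u, rfl⟩ := mk_surjective φ p
    obtain ⟨v, rfl⟩ := mk_surjective φ q
    rw [inner_mk, inner_mk, star_tensorForm]
  norm_eq_sqrt_norm_inner_self _ := rfl

instance : NormedAddCommGroup (PreInteriorTensor X φ) := CStarModule.normedAddCommGroup C

instance : NormedSpace ℂ (PreInteriorTensor X φ) := .ofCore (CStarModule.normedSpaceCore C)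

end PreInteriorTensor

/-- The interior tensor product `X ⊗_φ Y`: the completion of the algebraic tensor product modulo
the vectors of length zero. -/
abbrev InteriorTensor : Type _ := UniformSpace.Completion (PreInteriorTensor X φ)

variable {X}

/-- The elementary tensor `x ⊗ y` in `X ⊗_φ Y`. -/
def InteriorTensor.tmul (x : X) (y : Y) : InteriorTensor X φ :=
  (PreInteriorTensor.mk φ (x ⊗ₜ y) : PreInteriorTensor X φ)

theorem InteriorTensor.inner_tmul (x x' : X) (y y' : Y) :
    ⟪tmul φ x y, tmul φ x' y'⟫_C = ⟪y, (φ (unop ⟪x, x'⟫_Aᵐᵒᵖ)).1 y'⟫_C := by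
  rw [tmul, tmul, completion_inner_coe, PreInteriorTensor.inner_mk, tensorForm_tmul]

end InteriorTensor

end HilbertModule

end

namespace HilbertModule

/-! ### Frames in a single Hilbert module. -/

section Frames

variable {C E ι : Type*} [NonUnitalCStarAlgebra C] [PartialOrder C] [StarOrderedRing C]
  [NormedAddCommGroup E] [NormedSpace ℂ E] [SMul C E] [CStarModule C E]

/-! On an elementary tensor `u ⊗ v`, the frame sum over a rectangle is `∑ᵢ xᵢ ⊗ T φ((xᵢ|u)) v`, with
`T` a finite frame operator of `Y`. Letting the `Y`-side grow first gives `∑ᵢ xᵢ ⊗ φ((xᵢ|u)) v`,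
which equals `(∑ᵢ xᵢ · (xᵢ|u)) ⊗ v` because the tensor product is balanced; this tends to `u ⊗ v`.
So the identity is reached only as an iterated limit, on a dense set, along some rectangles.

Positivity turns this into convergence of the whole net. Finite frame operators increase with the
index set. If cofinally many of them approximate the identity on a dense set, each satisfies `0 ≤ S
≤ 1` (`inner_frameSum_le_of_frequently`), hence `S² ≤ S`, and for `S ≤ T ≤ 1` one gets `(1 - T)² ≤ 1
- T ≤ 1 - S`. One good finite set therefore controls all larger ones (`norm_sub_frameSum_sq_le`),
and no uniform boundedness theorem is needed.

Pointwise and strict convergence are linked in both directions. Pointwise convergence of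
self-adjoint contractions gives strict convergence, tested on rank-one operators. Conversely, strict
convergence gives convergence on vectors `Θ_{u,u} z`, which are dense by functional calculus
(`exists_rankOne_approx`). -/

theorem exists_cfcₙ_mul_approx (c : C) (hc : IsSelfAdjoint c) {ε : ℝ} (hε : 0 < ε) :
    ∃ a : C, IsSelfAdjoint (a * c) ∧
      ‖c - a * c * c - c * (a * c) + a * c * c * (a * c)‖ ≤ ε := by
  -- With `p = t g(t)`, the element to be estimated is `(1 - p) c (1 - p)`, expanded to avoid a
  -- unit. This regularised inverse `g` gives `1 - p = ε² / (ε² + t²)`, which is small where `t` is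
  -- large compared with `ε`.
  set g : ℝ → ℝ := fun t => t / (ε ^ 2 + t ^ 2) with hg
  have hpos : ∀ t : ℝ, 0 < ε ^ 2 + t ^ 2 := fun t => by positivity
  have hgc : Continuous g := by
    refine continuous_id.div (by fun_prop) fun t => (hpos t).ne'
  have hg0 : g 0 = 0 := by simp [hg]
  set p : ℝ → ℝ := fun t => g t * t with hp
  have hpc : Continuous p := hgc.mul continuous_id
  have hp0 : p 0 = 0 := by simp [hp]
  have hac : cfcₙ g c * c = cfcₙ p c := by
    conv_lhs => enter [2]; rw [← cfcₙ_id' ℝ c]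
    rw [← cfcₙ_mul g (fun t => t) c hgc.continuousOn hg0 continuousOn_id rfl]
  refine ⟨cfcₙ g c, ?_, ?_⟩
  · rw [hac]
    exact cfcₙ_predicate p c
  · rw [hac]
    have h1 : cfcₙ p c * c = cfcₙ (fun t => p t * t) c := by
      conv_lhs => enter [2]; rw [← cfcₙ_id' ℝ c]
      rw [← cfcₙ_mul p (fun t => t) c hpc.continuousOn hp0 continuousOn_id rfl]
    have h2 : c * cfcₙ p c = cfcₙ (fun t => t * p t) c := by
      conv_lhs => enter [1]; rw [← cfcₙ_id' ℝ c]
      rw [← cfcₙ_mul (fun t => t) p c continuousOn_id rfl hpc.continuousOn hp0]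
    have hq1 : Continuous fun t => p t * t := by fun_prop
    have hq2 : Continuous fun t => t * p t := by fun_prop
    have h3 : c - cfcₙ p c * c - c * cfcₙ p c + cfcₙ p c * c * cfcₙ p c =
        cfcₙ (fun t => t - p t * t - t * p t + p t * t * p t) c := by
      rw [h1, h2, ← cfcₙ_mul (fun t => p t * t) p c hq1.continuousOn (by simp) hpc.continuousOn hp0]
      conv_lhs => enter [1, 1, 1]; rw [← cfcₙ_id' ℝ c]
      rw [← cfcₙ_sub (fun t => t) (fun t => p t * t) c continuousOn_id rfl hq1.continuousOn
          (by simp),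
        ← cfcₙ_sub (fun t => t - p t * t) (fun t => t * p t) c (by fun_prop) (by simp)
          hq2.continuousOn (by simp),
        ← cfcₙ_add (fun t => t - p t * t - t * p t) (fun t => p t * t * p t) c (by fun_prop)
          (by simp) (by fun_prop) (by simp [hp0])]
    rw [h3]
    refine norm_cfcₙ_le fun t _ => ?_
    have h4 : t - p t * t - t * p t + p t * t * p t = t * (ε ^ 2 / (ε ^ 2 + t ^ 2)) ^ 2 := by
      have := (hpos t).ne'
      simp only [hp, hg]
      field_simp
      ring
    rw [h4, norm_mul, norm_pow, norm_div, Real.norm_eq_abs, Real.norm_eq_abs, Real.norm_eq_abs,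
      abs_of_pos (hpos t), abs_of_pos (show 0 < ε ^ 2 by positivity), div_pow, ← mul_div_assoc,
      div_le_iff₀ (by have := hpos t; positivity)]
    rw [← sq_abs t]
    have h5 : 0 ≤ |t| := abs_nonneg t
    generalize |t| = s at h5
    -- The claim is `s ε⁴ ≤ ε (ε² + s²)²`; half of `ε³ (ε - s)² ≥ 0` absorbs the term `s ε⁴`.
    nlinarith [mul_nonneg hε.le (sq_nonneg (ε ^ 2)), mul_nonneg hε.le (sq_nonneg (s ^ 2)),
      mul_nonneg (pow_pos hε 3).le (sq_nonneg (ε - s)),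
      mul_nonneg (pow_pos hε 3).le (sq_nonneg s)]

/-- Every vector `u` is a norm limit of vectors `Θ_{u,u} z`. -/
theorem exists_rankOne_approx (u : E) {ε : ℝ} (hε : 0 < ε) :
    ∃ z : E, ‖u - (rankOne (C := C) u u).1 z‖ ≤ ε := by
  obtain ⟨a, ha, hle⟩ := exists_cfcₙ_mul_approx ⟪u, u⟫_C CStarModule.isSelfAdjoint_inner_self
    (show 0 < ε ^ 2 by positivity)
  -- Here `Θ_{u,u}` sends `a • u` to `(a * ⟪u, u⟫) • u`, so the squared error is the norm bounded
  -- above; hence the tolerance `ε ^ 2`.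
  refine ⟨a • u, abs_le_of_sq_le_sq' ?_ hε.le |>.2⟩
  rw [CStarModule.norm_sq_eq C, rankOne_apply, CStarModule.inner_op_smul_right]
  have h : ⟪u - (a * ⟪u, u⟫_C) • u, u - (a * ⟪u, u⟫_C) • u⟫_C =
      ⟪u, u⟫_C - a * ⟪u, u⟫_C * ⟪u, u⟫_C - ⟪u, u⟫_C * (a * ⟪u, u⟫_C) +
        a * ⟪u, u⟫_C * ⟪u, u⟫_C * (a * ⟪u, u⟫_C) := by
    rw [CStarModule.inner_sub_left, CStarModule.inner_sub_right, CStarModule.inner_sub_right,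
      CStarModule.inner_op_smul_left, CStarModule.inner_op_smul_left,
      CStarModule.inner_op_smul_right, ha.star_eq]
    abel
  rwa [h]

/-! ### Finite frame operators and their order properties. -/

variable (C)

/-- The frame operator `∑_{i ∈ s} Θ_{z_i, z_i}` of a finite part of a family. -/
noncomputable def frameSum (z : ι → E) (s : Finset ι) : Adjointable C E :=
  ∑ i ∈ s, rankOne (C := C) (z i) (z i)

variable {C}

theorem frameSum_apply (z : ι → E) (s : Finset ι) (w : E) :
    (frameSum C z s).1 w = ∑ i ∈ s, ⟪z i, w⟫_C • z i := by
  simp [frameSum, rankOne_apply]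

theorem inner_frameSum_right (z : ι → E) (s : Finset ι) (v w : E) :
    ⟪v, (frameSum C z s).1 w⟫_C = ∑ i ∈ s, ⟪z i, w⟫_C * ⟪v, z i⟫_C := by
  simp [frameSum_apply]

theorem inner_frameSum_left (z : ι → E) (s : Finset ι) (v w : E) :
    ⟪(frameSum C z s).1 v, w⟫_C = ⟪v, (frameSum C z s).1 w⟫_C := by
  simp [frameSum_apply]

theorem inner_frameSum_mono (z : ι → E) {s t : Finset ι} (h : s ⊆ t) (w : E) :
    ⟪w, (frameSum C z s).1 w⟫_C ≤ ⟪w, (frameSum C z t).1 w⟫_C := by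
  rw [inner_frameSum_right (C := C), inner_frameSum_right (C := C)]
  refine Finset.sum_le_sum_of_subset_of_nonneg h fun i _ _ => ?_
  rw [← CStarModule.star_inner (A := C) w (z i)]
  exact star_mul_self_nonneg (⟪w, z i⟫_C)

theorem inner_frameSum_nonneg (z : ι → E) (s : Finset ι) (w : E) :
    0 ≤ ⟪w, (frameSum C z s).1 w⟫_C := by
  simpa [frameSum_apply] using inner_frameSum_mono (C := C) z (Finset.empty_subset s) w

theorem closed_setOf_inner_frameSum_le (z : ι → E) (s : Finset ι) :
    IsClosed {w : E | ⟪w, (frameSum C z s).1 w⟫_C ≤ ⟪w, w⟫_C} :=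
  isClosed_le
    ((CStarModule.continuous_inner (A := C)).comp (continuous_id.prodMk (frameSum C z s).1.continuous))
    ((CStarModule.continuous_inner (A := C)).comp (continuous_id.prodMk continuous_id))

section Contractive

variable {z : ι → E} (hz : ∀ (s : Finset ι) (w : E), ⟪w, (frameSum C z s).1 w⟫_C ≤ ⟪w, w⟫_C)
include hz

/-- This is `S² ≤ S`, obtained without square roots: `S - S² = (S² - S³) + (1 - S) S (1 - S)`. The
first summand is nonnegative by `S ≤ 1` at `S w`, the second by `S ≥ 0` at `w - S w`. -/
theorem inner_frameSum_frameSum_le (s : Finset ι) (w : E) :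
    ⟪(frameSum C z s).1 w, (frameSum C z s).1 w⟫_C ≤ ⟪w, (frameSum C z s).1 w⟫_C := by
  set S := frameSum C z s
  have h1 : 0 ≤ ⟪S.1 w, S.1 w⟫_C - ⟪S.1 w, S.1 (S.1 w)⟫_C := sub_nonneg.mpr (hz s (S.1 w))
  have h2 : 0 ≤ ⟪w - S.1 w, S.1 (w - S.1 w)⟫_C := inner_frameSum_nonneg z s _
  have h3 := add_nonneg h1 h2
  have hl : ∀ v v' : E, ⟪S.1 v, v'⟫_C = ⟪v, S.1 v'⟫_C := inner_frameSum_left z s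
  simp only [map_sub, CStarModule.inner_sub_left, CStarModule.inner_sub_right, hl] at h3 ⊢
  rw [← sub_nonneg]
  convert h3 using 1
  abel

theorem norm_frameSum_apply_le (s : Finset ι) (w : E) : ‖(frameSum C z s).1 w‖ ≤ ‖w‖ := by
  refine abs_le_of_sq_le_sq' ?_ (norm_nonneg _) |>.2
  rw [CStarModule.norm_sq_eq C, CStarModule.norm_sq_eq C]
  exact CStarAlgebra.norm_le_norm_of_nonneg_of_le CStarModule.inner_self_nonneg
    ((inner_frameSum_frameSum_le hz s w).trans (hz s w))

/-- From `(1 - T)² ≤ 1 - T ≤ 1 - S`, followed by Cauchy–Schwarz for `⟪w, (1 - S) w⟫`. A small error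
at one finite set thus persists at every larger one. -/
theorem norm_sub_frameSum_sq_le {s t : Finset ι} (h : s ⊆ t) (w : E) :
    ‖w - (frameSum C z t).1 w‖ ^ 2 ≤ ‖w‖ * ‖w - (frameSum C z s).1 w‖ := by
  rw [CStarModule.norm_sq_eq C]
  refine le_trans ?_ (CStarModule.norm_inner_le (A := C) E)
  refine CStarAlgebra.norm_le_norm_of_nonneg_of_le CStarModule.inner_self_nonneg ?_
  have h1 := inner_frameSum_frameSum_le hz t w
  have h2 := inner_frameSum_mono (C := C) z h w
  simp only [CStarModule.inner_sub_left, CStarModule.inner_sub_right, inner_frameSum_left] at h1 ⊢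
  rw [sub_sub]
  refine sub_le_sub_left (h2.trans ?_) _
  rw [← sub_nonneg] at h1 ⊢
  convert h1 using 1
  abel

theorem norm_sub_frameSum_le (s : Finset ι) (v w : E) :
    ‖w - (frameSum C z s).1 w‖ ≤ 2 * ‖w - v‖ + ‖v - (frameSum C z s).1 v‖ := by
  have h1 : w - (frameSum C z s).1 w =
      (w - v) - (frameSum C z s).1 (w - v) + (v - (frameSum C z s).1 v) := by
    rw [map_sub]; abel
  have h2 := norm_frameSum_apply_le hz s (w - v)
  rw [h1]
  have h3 := norm_add_le ((w - v) - (frameSum C z s).1 (w - v)) (v - (frameSum C z s).1 v)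
  have h4 := norm_sub_le (w - v) ((frameSum C z s).1 (w - v))
  linarith

end Contractive

/-- A family is reconstructing on a dense set if finite frame operators, cofinally often,
approximate the identity at each vector of the set; then they are contractive. -/
theorem inner_frameSum_le_of_frequently {z : ι → E} {D : Set E} (hD : Dense D)
    (h : ∀ w ∈ D, ∀ ε > 0, ∃ᶠ t in atTop, ‖w - (frameSum C z t).1 w‖ < ε)
    (s : Finset ι) (w : E) : ⟪w, (frameSum C z s).1 w⟫_C ≤ ⟪w, w⟫_C := by
  refine (closed_setOf_inner_frameSum_le (C := C) z s).closure_subset_iff.mpr ?_ (hD w)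
  intro w hw
  have hfreq : ∀ n : ℕ, ∃ t ≥ s, ‖w - (frameSum C z t).1 w‖ < 1 / ((n : ℝ) + 1) := fun n =>
    frequently_atTop.mp (h w hw _ (by positivity)) s
  choose t hts ht using hfreq
  have hlim : Tendsto (fun n => (frameSum C z (t n)).1 w) atTop (𝓝 w) := by
    rw [tendsto_iff_norm_sub_tendsto_zero]
    refine squeeze_zero (fun _ => norm_nonneg _) (fun n => ?_)
      tendsto_one_div_add_atTop_nhds_zero_nat
    rw [norm_sub_rev]
    exact (ht n).le
  have hlim' : Tendsto (fun n => ⟪w, (frameSum C z (t n)).1 w⟫_C) atTop (𝓝 ⟪w, w⟫_C) :=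
    (CStarModule.continuous_inner.tendsto (w, w)).comp (tendsto_const_nhds.prodMk_nhds hlim)
  -- Each `t n` contains `s`, so the form of `S_s` lies below forms that converge to `⟪w, w⟫`.
  exact ge_of_tendsto' hlim' fun n => inner_frameSum_mono z (hts n) w

theorem tendsto_frameSum_of_frequently {z : ι → E} {D : Set E} (hD : Dense D)
    (h : ∀ w ∈ D, ∀ ε > 0, ∃ᶠ t in atTop, ‖w - (frameSum C z t).1 w‖ < ε) (w : E) :
    Tendsto (fun s => (frameSum C z s).1 w) atTop (𝓝 w) := by
  have hz := inner_frameSum_le_of_frequently (C := C) hD h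
  rw [Metric.tendsto_nhds]
  intro ε hε
  obtain ⟨v, hv, hvw⟩ := Metric.dense_iff.mp hD w (ε / 4) (by positivity)
  rw [Metric.mem_ball, dist_eq_norm, norm_sub_rev] at hv
  -- The tolerance compensates for the square and the factor `‖v‖` in `norm_sub_frameSum_sq_le`; the
  -- `+ 1` covers `v = 0`.
  obtain ⟨s, -, hs⟩ := frequently_atTop.mp
    (h v hvw ((ε / 2) ^ 2 / (‖v‖ + 1)) (by positivity)) ∅
  filter_upwards [eventually_ge_atTop s] with t ht
  have h1 := norm_sub_frameSum_sq_le hz ht v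
  have h2 : ‖v - (frameSum C z t).1 v‖ < ε / 2 := by
    refine lt_of_pow_lt_pow_left₀ 2 (by positivity) (h1.trans_lt ?_)
    rw [lt_div_iff₀ (by positivity)] at hs
    nlinarith [norm_nonneg (v - (frameSum C z s).1 v), sq_pos_of_pos hε]
  have h3 := norm_sub_frameSum_le hz t v w
  rw [dist_eq_norm, norm_sub_rev]
  linarith

/-! ### Strict convergence versus pointwise convergence. -/

theorem norm_rankOne_le (u v : E) : ‖rankOne (C := C) u v‖ ≤ ‖v‖ * ‖u‖ :=
  LinearMap.mkContinuous_norm_le _ (by positivity) fun z =>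
    (norm_smul_le' C _ _).trans <| by
      have := CStarModule.norm_inner_le (A := C) E (x := v) (y := z)
      calc ‖⟪v, z⟫_C‖ * ‖u‖ ≤ (‖v‖ * ‖z‖) * ‖u‖ := by gcongr
        _ = ‖v‖ * ‖u‖ * ‖z‖ := by ring

theorem tendsto_strict_iff {α : Type*} {l : Filter α} {T : α → Adjointable C E} :
    Tendsto T l (@nhds _ (strictTopology C E) 1) ↔
      ∀ K ∈ compacts C E, Tendsto (fun a => T a * K) l (𝓝 K) ∧
        Tendsto (fun a => K * T a) l (𝓝 K) := by
  rw [nhds_induced, tendsto_comap_iff, tendsto_pi_nhds]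
  simp only [Function.comp_def, Subtype.forall, one_mul, mul_one]
  refine forall₂_congr fun K hK => ?_
  rw [nhds_prod_eq, tendsto_prod_iff']

/-- For linear contractions, the vectors on which they tend to the identity form a closed subspace.
This reduces strict convergence to rank-one operators. -/
theorem tendsto_of_mem_closure_span {V α : Type*} [SeminormedAddCommGroup V] [NormedSpace ℂ V]
    {l : Filter α} (F : α → V →ₗ[ℂ] V) (hF : ∀ a v, ‖F a v‖ ≤ ‖v‖) {S : Set V}
    (hS : ∀ v ∈ S, Tendsto (fun a => F a v) l (𝓝 v)) {v : V}
    (hv : v ∈ (Submodule.span ℂ S).topologicalClosure) :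
    Tendsto (fun a => F a v) l (𝓝 v) := by
  have hspan : ∀ w ∈ Submodule.span ℂ S, Tendsto (fun a => F a w) l (𝓝 w) := fun w hw => by
    induction hw using Submodule.span_induction with
    | mem w hw => exact hS w hw
    | zero => simpa using tendsto_const_nhds
    | add w w' _ _ h h' => simpa using h.add h'
    | smul t w _ h => simpa using h.const_smul t
  rw [Metric.tendsto_nhds]
  intro ε hε
  obtain ⟨w, hw, hvw⟩ := Metric.mem_closure_iff.mp hv (ε / 3) (by positivity)
  filter_upwards [Metric.tendsto_nhds.mp (hspan w hw) (ε / 3) (by positivity)] with a ha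
  have h1 := hF a (v - w)
  rw [map_sub, ← dist_eq_norm, ← dist_eq_norm] at h1
  have h2 := dist_triangle4 (F a v) (F a w) w v
  rw [dist_comm w v] at h2
  linarith

theorem norm_frameSum_le {z : ι → E}
    (hz : ∀ (s : Finset ι) (w : E), ⟪w, (frameSum C z s).1 w⟫_C ≤ ⟪w, w⟫_C) (s : Finset ι) :
    ‖frameSum C z s‖ ≤ 1 :=
  ContinuousLinearMap.opNorm_le_bound _ zero_le_one fun w => by
    rw [one_mul]
    exact norm_frameSum_apply_le hz s w

theorem rankOne_sub_left (u u' v : E) :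
    rankOne (C := C) u v - rankOne u' v = rankOne (u - u') v :=
  Subtype.ext <| ContinuousLinearMap.ext fun w => by
    change ⟪v, w⟫_C • u - ⟪v, w⟫_C • u' = ⟪v, w⟫_C • (u - u')
    rw [smul_sub']

theorem rankOne_sub_right (u v v' : E) :
    rankOne (C := C) u v - rankOne u v' = rankOne u (v - v') :=
  Subtype.ext <| ContinuousLinearMap.ext fun w => ext_inner C fun w' => by
    change ⟪w', ⟪v, w⟫_C • u - ⟪v', w⟫_C • u⟫_C = ⟪w', ⟪v - v', w⟫_C • u⟫_C
    simp [sub_mul]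

theorem frameSum_mul_rankOne (z : ι → E) (s : Finset ι) (u v : E) :
    frameSum C z s * rankOne u v = rankOne ((frameSum C z s).1 u) v :=
  Subtype.ext <| ContinuousLinearMap.ext fun w => ext_inner C fun w' => by
    change ⟪w', (frameSum C z s).1 (⟪v, w⟫_C • u)⟫_C = ⟪w', ⟪v, w⟫_C • (frameSum C z s).1 u⟫_C
    rw [← inner_frameSum_left, CStarModule.inner_op_smul_right, inner_frameSum_left,
      CStarModule.inner_op_smul_right]

theorem rankOne_mul_frameSum (z : ι → E) (s : Finset ι) (u v : E) :
    rankOne u v * frameSum C z s = rankOne u ((frameSum C z s).1 v) :=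
  Subtype.ext <| ContinuousLinearMap.ext fun w => by
    change ⟪v, (frameSum C z s).1 w⟫_C • u = ⟪(frameSum C z s).1 v, w⟫_C • u
    rw [inner_frameSum_left]

/-- Pointwise approximation on a dense set gives strict convergence. -/
theorem isUnorderedFrame_of_frequently {z : ι → E} {D : Set E} (hD : Dense D)
    (h : ∀ w ∈ D, ∀ ε > 0, ∃ᶠ t in atTop, ‖w - (frameSum C z t).1 w‖ < ε) :
    IsUnorderedFrame C z := by
  have hz := inner_frameSum_le_of_frequently (C := C) hD h
  have hlim := tendsto_frameSum_of_frequently (C := C) hD h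
  have hnorm := norm_frameSum_le hz
  -- Multiplication by `S` on either side is contractive, and `S Θ_{u,v} = Θ_{Su,v}`, `Θ_{u,v} S =
  -- Θ_{u,Sv}` since `S` is self-adjoint.
  refine tendsto_strict_iff.mpr fun K hK => ⟨?_, ?_⟩
  · refine tendsto_of_mem_closure_span (fun s => LinearMap.mulLeft ℂ (frameSum C z s))
      (fun s T => ?_) ?_ hK
    · exact (norm_mul_le _ _).trans (mul_le_of_le_one_left (norm_nonneg _) (hnorm s))
    · rintro _ ⟨⟨u, v⟩, rfl⟩
      rw [tendsto_iff_norm_sub_tendsto_zero]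
      refine squeeze_zero (fun _ => norm_nonneg _) (fun s => ?_)
        (by simpa using (tendsto_iff_norm_sub_tendsto_zero.mp (hlim u)).const_mul ‖v‖)
      rw [LinearMap.mulLeft_apply, frameSum_mul_rankOne, rankOne_sub_left]
      exact norm_rankOne_le _ _
  · refine tendsto_of_mem_closure_span (fun s => LinearMap.mulRight ℂ (frameSum C z s))
      (fun s T => ?_) ?_ hK
    · exact (norm_mul_le _ _).trans (mul_le_of_le_one_right (norm_nonneg _) (hnorm s))
    · rintro _ ⟨⟨u, v⟩, rfl⟩
      rw [tendsto_iff_norm_sub_tendsto_zero]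
      refine squeeze_zero (fun _ => norm_nonneg _) (fun s => ?_)
        (by simpa using (tendsto_iff_norm_sub_tendsto_zero.mp (hlim v)).mul_const ‖u‖)
      rw [LinearMap.mulRight_apply, rankOne_mul_frameSum, rankOne_sub_right]
      exact norm_rankOne_le _ _

/-- A countable frame reconstructs every vector in norm. -/
theorem IsCountableFrame.tendsto_frameSum {z : ℕ → E} (hz : IsCountableFrame C z) (w : E) :
    Tendsto (fun n => (frameSum C z (Finset.range n)).1 w) atTop (𝓝 w) := by
  refine (tendsto_frameSum_of_frequently
    (D := Set.range fun p : E × E => (rankOne (C := C) p.1 p.1).1 p.2) ?_ ?_ w).comp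
    tendsto_finset_range
  · refine Metric.dense_iff.mpr fun u ε hε => ?_
    obtain ⟨v, hv⟩ := exists_rankOne_approx (C := C) u (half_pos hε)
    refine ⟨_, ?_, ⟨(u, v), rfl⟩⟩
    rw [Metric.mem_ball, dist_eq_norm, norm_sub_rev]
    linarith
  · rintro _ ⟨⟨u, v⟩, rfl⟩ ε hε
    have hK : rankOne (C := C) u u ∈ compacts C E :=
      Submodule.le_topologicalClosure _ (Submodule.subset_span ⟨(u, u), rfl⟩)
    have h1 := (tendsto_strict_iff.mp hz _ hK).1
    have h2 : Tendsto (fun n => (frameSum C z (Finset.range n)).1 ((rankOne (C := C) u u).1 v))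
        atTop (𝓝 ((rankOne (C := C) u u).1 v)) :=
      ((ContinuousLinearMap.apply ℂ E v).continuous.comp
        continuous_subtype_val).continuousAt.tendsto.comp h1
    -- The initial segments are merely cofinal among finite sets, which is all that is required.
    refine tendsto_finset_range.frequently (Eventually.frequently ?_)
    filter_upwards [Metric.tendsto_nhds.mp h2 ε hε] with n hn
    rwa [norm_sub_rev, ← dist_eq_norm]

/-- An unordered frame is a countable frame in every enumeration. -/
theorem IsUnorderedFrame.isCountableFrame {z : ι → E} (hz : IsUnorderedFrame C z) (e : ℕ ≃ ι) :
    IsCountableFrame C (fun n => z (e n)) := by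
  have h : Tendsto (fun n => (Finset.range n).map e.toEmbedding) atTop atTop := by
    -- The index `i` is enumerated at `e.symm i`, so it first enters with the range of length
    -- `e.symm i + 1`.
    refine tendsto_atTop_finset_of_monotone
      (fun m n h => Finset.map_subset_map.mpr (Finset.range_mono h)) fun i => ⟨e.symm i + 1, ?_⟩
    simp
  refine (Tendsto.comp hz h).congr fun n => ?_
  simp

end Frames

/-! ### The C⋆-algebra of adjointable operators. -/

section AdjointableCStar

variable {C Y : Type*} [NonUnitalCStarAlgebra C] [PartialOrder C] [StarOrderedRing C]
  [NormedAddCommGroup Y] [NormedSpace ℂ Y] [SMul C Y] [CStarModule C Y]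

namespace Adjointable

/-- Cauchy–Schwarz applied to `⟪T y, T y⟫ = ⟪y, T⋆ T y⟫`. -/
theorem norm_mul_self_le (T : Adjointable C Y) : ‖T‖ * ‖T‖ ≤ ‖star T * T‖ := by
  have h : ‖T‖ ≤ √‖star T * T‖ :=
    ContinuousLinearMap.opNorm_le_bound _ (Real.sqrt_nonneg _) fun y => by
      refine abs_le_of_sq_le_sq' ?_ (by positivity) |>.2
      change ‖T.1 y‖ ^ 2 ≤ _
      rw [CStarModule.norm_sq_eq C, inner_left, mul_pow, Real.sq_sqrt (show 0 ≤ ‖star T * T‖ from norm_nonneg _)]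
      refine (CStarModule.norm_inner_le (A := C) Y).trans ?_
      have := (star T * T).1.le_opNorm y
      calc ‖y‖ * ‖(star T).1 (T.1 y)‖ ≤ ‖y‖ * (‖star T * T‖ * ‖y‖) := by gcongr; exact this
        _ = ‖star T * T‖ * ‖y‖ ^ 2 := by ring
  calc ‖T‖ * ‖T‖ ≤ √‖star T * T‖ * √‖star T * T‖ := by gcongr
    _ = ‖star T * T‖ := Real.mul_self_sqrt (norm_nonneg _)

instance : CStarRing (Adjointable C Y) where
  norm_mul_self_le := norm_mul_self_le

instance : StarModule ℂ (Adjointable C Y) where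
  star_smul t T := eq_star fun x y => by
    change ⟪t • T.1 x, y⟫_C = ⟪x, star t • (star T).1 y⟫_C
    simp [inner_left]

/-- The star is isometric, so the adjoints of a Cauchy sequence are Cauchy too, and their limit is
an adjoint of the limit. -/
instance [CompleteSpace Y] : CompleteSpace (Adjointable C Y) := by
  refine Metric.complete_of_cauchySeq_tendsto fun T hT => ?_
  have hval : ∀ {R : ℕ → Adjointable C Y}, CauchySeq R → CauchySeq fun n => (R n).1 :=
    fun hR => hR.map uniformContinuous_subtype_val
  obtain ⟨T₀, hT₀⟩ := cauchySeq_tendsto_of_complete (hval hT)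
  obtain ⟨S₀, hS₀⟩ := cauchySeq_tendsto_of_complete
    (hval (R := fun n => star (T n))
      (hT.map (starₗᵢ ℂ (E := Adjointable C Y)).isometry.uniformContinuous))
  have happ : ∀ {R : ℕ → Y →L[ℂ] Y} {R₀ : Y →L[ℂ] Y}, Tendsto R atTop (𝓝 R₀) → ∀ y,
      Tendsto (fun n => R n y) atTop (𝓝 (R₀ y)) := fun h y =>
    (ContinuousLinearMap.apply ℂ Y y).continuous.continuousAt.tendsto.comp h
  refine ⟨⟨T₀, S₀, fun x y => ?_⟩, tendsto_subtype_rng.mpr hT₀⟩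
  refine tendsto_nhds_unique (f := fun n => ⟪(T n).1 x, y⟫_C) (l := atTop)
    ((CStarModule.continuous_inner.tendsto (T₀ x, y)).comp
      ((happ hT₀ x).prodMk_nhds tendsto_const_nhds)) ?_
  refine Tendsto.congr (fun n => (inner_left (T n) x y).symm)
    (((CStarModule.continuous_inner (A := C)).tendsto (x, S₀ y)).comp
      (tendsto_const_nhds.prodMk_nhds (happ hS₀ y)))

/-- This makes the ⋆-homomorphism `φ` automatically norm decreasing, as used in `norm_tmul_le`. -/
noncomputable instance [CompleteSpace Y] : NonUnitalCStarAlgebra (Adjointable C Y) where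

end Adjointable

end AdjointableCStar

/-! ### Frames of the interior tensor product. -/

section Tensor

variable {A C X Y : Type*} [NonUnitalCStarAlgebra A] [PartialOrder A] [StarOrderedRing A]
  [NonUnitalCStarAlgebra C] [PartialOrder C] [StarOrderedRing C]
  [NormedAddCommGroup X] [NormedSpace ℂ X] [SMul Aᵐᵒᵖ X] [CStarModule Aᵐᵒᵖ X]
  [NormedAddCommGroup Y] [NormedSpace ℂ Y] [SMul C Y] [CStarModule C Y]
  (φ : A →⋆ₙₐ[ℂ] Adjointable C Y)

namespace InteriorTensor

variable (X) in
/-- The canonical map of the algebraic tensor product to the interior tensor product. -/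
noncomputable def ofTensor : X ⊗[ℂ] Y →ₗ[ℂ] InteriorTensor X φ :=
  (UniformSpace.Completion.toComplL (𝕜 := ℂ) (E := PreInteriorTensor X φ)).toLinearMap ∘ₗ
    PreInteriorTensor.mk φ

theorem ofTensor_tmul (x : X) (y : Y) : ofTensor X φ (x ⊗ₜ y) = tmul φ x y := rfl

theorem ofTensor_smul (c : C) (u : X ⊗[ℂ] Y) :
    c • ofTensor X φ u = ofTensor X φ (tensorAct c u) := by
  change c • ((PreInteriorTensor.mk φ u : PreInteriorTensor X φ) : InteriorTensor X φ) = _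
  rw [← completion_coe_smul, PreInteriorTensor.smul_mk]
  rfl

theorem denseRange_ofTensor : DenseRange (ofTensor X φ) :=
  UniformSpace.Completion.denseRange_coe.comp (PreInteriorTensor.mk_surjective φ).denseRange
    (UniformSpace.Completion.continuous_coe _)

theorem smul_tmul (c : C) (x : X) (y : Y) : c • tmul φ x y = tmul φ x (c • y) :=
  ofTensor_smul φ c (x ⊗ₜ y)

/-- The action is balanced: `x · a ⊗ y = x ⊗ φ(a) y`. -/
theorem smul_tmul_eq (a : A) (x : X) (y : Y) :
    tmul φ (op a • x) y = tmul φ x ((φ a).1 y) := by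
  change ((PreInteriorTensor.mk φ ((op a • x) ⊗ₜ y) : PreInteriorTensor X φ) : InteriorTensor X φ) =
    (PreInteriorTensor.mk φ (x ⊗ₜ (φ a).1 y) : PreInteriorTensor X φ)
  congr 1
  -- Both classes have the same inner products with elementary tensors, because `(x'|x · a) = (x'|x)
  -- a` and `φ` is multiplicative.
  refine ext_inner C fun z => ?_
  obtain ⟨u, rfl⟩ := PreInteriorTensor.mk_surjective φ z
  rw [PreInteriorTensor.inner_mk, PreInteriorTensor.inner_mk]
  induction u with
  | zero => simp
  | add u v hu hv => simp [hu, hv]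
  | tmul x' y' => simp [tensorForm_tmul]

variable [CompleteSpace Y]

theorem norm_tmul_le (x : X) (y : Y) : ‖tmul φ x y‖ ≤ ‖x‖ * ‖y‖ := by
  refine abs_le_of_sq_le_sq' ?_ (by positivity) |>.2
  rw [CStarModule.norm_sq_eq C, inner_tmul]
  have h1 : ‖φ (unop ⟪x, x⟫_Aᵐᵒᵖ)‖ ≤ ‖x‖ ^ 2 := by
    rw [CStarModule.norm_sq_eq Aᵐᵒᵖ]
    exact NonUnitalStarAlgHom.norm_apply_le φ _
  calc _ ≤ ‖y‖ * ‖(φ (unop ⟪x, x⟫_Aᵐᵒᵖ)).1 y‖ := CStarModule.norm_inner_le Y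
    _ ≤ ‖y‖ * (‖φ (unop ⟪x, x⟫_Aᵐᵒᵖ)‖ * ‖y‖) := by
        gcongr
        exact ContinuousLinearMap.le_opNorm _ _
    _ ≤ ‖y‖ * (‖x‖ ^ 2 * ‖y‖) := by gcongr
    _ = (‖x‖ * ‖y‖) ^ 2 := by ring

/-- The elementary tensor as a bounded bilinear map. -/
noncomputable def tmulCLM : X →L[ℂ] Y →L[ℂ] InteriorTensor X φ :=
  LinearMap.mkContinuous₂ ((TensorProduct.mk ℂ X Y).compr₂ (ofTensor X φ)) 1 fun x y => by
    rw [one_mul]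
    exact norm_tmul_le φ x y

theorem tmulCLM_apply (x : X) (y : Y) : tmulCLM φ x y = tmul φ x y := rfl

variable {x : ℕ → X} {y : ℕ → Y}

/-- Since `(xᵢ ⊗ yⱼ | u ⊗ v) = (yⱼ | φ((xᵢ|u)) v)`, for fixed `i` the sum over `j` is a frame
operator of `Y` applied to `φ((xᵢ|u)) v`. -/
theorem frameSum_tmul (s t : Finset ℕ) (u : X) (v : Y) :
    (frameSum C (fun p : ℕ × ℕ => tmul φ (x p.1) (y p.2)) (s ×ˢ t)).1 (tmul φ u v) =
      ∑ i ∈ s, tmul φ (x i) ((frameSum C y t).1 ((φ (unop ⟪x i, u⟫_Aᵐᵒᵖ)).1 v)) := by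
  rw [frameSum_apply, Finset.sum_product]
  refine Finset.sum_congr rfl fun i _ => ?_
  simp only [frameSum_apply, ← tmulCLM_apply, map_sum]
  simp only [tmulCLM_apply, inner_tmul, smul_tmul]

/-- The products of finite parts of two frames approximate the identity on algebraic tensors,
as an iterated limit. -/
theorem exists_iterated_limit (hx : IsCountableFrame Aᵐᵒᵖ x) (hy : IsCountableFrame C y)
    (u : X ⊗[ℂ] Y) :
    ∃ W : ℕ → InteriorTensor X φ, (∀ n, Tendsto (fun m =>
      (frameSum C (fun p : ℕ × ℕ => tmul φ (x p.1) (y p.2))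
        (Finset.range n ×ˢ Finset.range m)).1 (ofTensor X φ u)) atTop (𝓝 (W n))) ∧
      Tendsto W atTop (𝓝 (ofTensor X φ u)) := by
  induction u with
  | zero => exact ⟨0, fun n => by simp, by
      rw [map_zero]; exact tendsto_const_nhds⟩
  | add u v hu hv =>
    obtain ⟨W, h1, h2⟩ := hu
    obtain ⟨W', h1', h2'⟩ := hv
    exact ⟨W + W', fun n => by simpa using (h1 n).add (h1' n), by
      rw [map_add]; exact h2.add h2'⟩
  | tmul u v =>
    -- The limit in `m` is `∑ xᵢ ⊗ φ((xᵢ|u)) v`; moving `φ((xᵢ|u))` across the tensor sign yields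
    -- this witness.
    refine ⟨fun n => tmul φ ((frameSum Aᵐᵒᵖ x (Finset.range n)).1 u) v, fun n => ?_, ?_⟩
    · have h : tmul φ ((frameSum Aᵐᵒᵖ x (Finset.range n)).1 u) v =
          ∑ i ∈ Finset.range n, tmul φ (x i) ((φ (unop ⟪x i, u⟫_Aᵐᵒᵖ)).1 v) := by
        rw [frameSum_apply, ← tmulCLM_apply, map_sum, sum_apply]
        refine Finset.sum_congr rfl fun i _ => ?_
        rw [tmulCLM_apply, ← smul_tmul_eq, op_unop]
      simp only [h, ofTensor_tmul, frameSum_tmul]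
      exact tendsto_finsetSum _ fun i _ =>
        ((tmulCLM φ (x i)).continuous.tendsto _).comp (hy.tendsto_frameSum _)
    · exact (((tmulCLM φ).flip v).continuous.tendsto _).comp (hx.tendsto_frameSum u)

theorem isUnorderedFrame_tmul (hx : IsCountableFrame Aᵐᵒᵖ x) (hy : IsCountableFrame C y) :
    IsUnorderedFrame C (fun p : ℕ × ℕ => tmul φ (x p.1) (y p.2)) := by
  refine isUnorderedFrame_of_frequently (denseRange_ofTensor (X := X) φ) ?_
  rintro _ ⟨u, rfl⟩ ε hε
  obtain ⟨W, h1, h2⟩ := exists_iterated_limit φ hx hy u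
  rw [frequently_atTop]
  intro s
  -- A bound on all coordinates in `s`: any rectangle with both sides at least `k` contains `s`. The
  -- side `n` is fixed first, and `m` is chosen depending on it.
  obtain ⟨k, hk⟩ := (s.image Prod.fst ∪ s.image Prod.snd).exists_nat_subset_range
  obtain ⟨n, hn, hkn⟩ := ((Metric.tendsto_nhds.mp h2 (ε / 2) (half_pos hε)).and
    (eventually_ge_atTop k)).exists
  obtain ⟨m, hm, hkm⟩ := ((Metric.tendsto_nhds.mp (h1 n) (ε / 2) (half_pos hε)).and
    (eventually_ge_atTop k)).exists
  refine ⟨Finset.range n ×ˢ Finset.range m, fun p hp => ?_, ?_⟩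
  · have hp1 := hk (Finset.mem_union_left _ (Finset.mem_image_of_mem _ hp))
    have hp2 := hk (Finset.mem_union_right _ (Finset.mem_image_of_mem _ hp))
    rw [Finset.mem_range] at hp1 hp2
    exact Finset.mem_product.mpr
      ⟨Finset.mem_range.mpr (hp1.trans_le hkn), Finset.mem_range.mpr (hp2.trans_le hkm)⟩
  · rw [norm_sub_rev, ← dist_eq_norm]
    exact (dist_triangle _ (W n) _).trans_lt (by linarith)

end InteriorTensor

end Tensor

end HilbertModule

open HilbertModule in
theorem mainTheorem9
    {A B : Type*} [NonUnitalCStarAlgebra A] [PartialOrder A] [StarOrderedRing A]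
    [NonUnitalCStarAlgebra B] [PartialOrder B] [StarOrderedRing B]
    -- `X` is a right Hilbert `A`-module, `(φ, Y)` is an `A`-`B`-correspondence
    {X : Type*} [NormedAddCommGroup X] [NormedSpace ℂ X] [CompleteSpace X]
    [SMul Aᵐᵒᵖ X] [CStarModule Aᵐᵒᵖ X]
    {Y : Type*} [NormedAddCommGroup Y] [NormedSpace ℂ Y] [CompleteSpace Y]
    [SMul Bᵐᵒᵖ Y] [CStarModule Bᵐᵒᵖ Y]
    (φ : A →⋆ₙₐ[ℂ] Adjointable Bᵐᵒᵖ Y)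
    (x : ℕ → X) (hx : IsCountableFrame Aᵐᵒᵖ x)
    (y : ℕ → Y) (hy : IsCountableFrame Bᵐᵒᵖ y) :
    IsUnorderedFrame Bᵐᵒᵖ (fun p : ℕ × ℕ => InteriorTensor.tmul φ (x p.1) (y p.2)) ∧
    ∀ e : ℕ ≃ ℕ × ℕ,
      IsCountableFrame Bᵐᵒᵖ (fun n => InteriorTensor.tmul φ (x (e n).1) (y (e n).2)) := by
  have h := InteriorTensor.isUnorderedFrame_tmul φ hx hy
  exact ⟨h, h.isCountableFrame⟩
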